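/- Let $n \ge 1$, let $K \subset \mathbb{R}^n$ be a convex body (a compact convex set with non-empty interior) and let $\Lambda \subset \mathbb{R}^n$ be an $n$-dimensional lattice, that is, $\Lambda = B\mathbb{Z}^n$ for some invertible matrix $B \in \mathbb{R}^{n\times n}$. For $1 \le i \le n$ let the $i$th packing minimum be $$\rho_i(K,\Lambda) = \inf\{\rho > 0 : (\rho\,(K-K) + L)\cap\Lambda \neq L\cap\Lambda \text{ for all } (n-i)\text{-dimensional linear subspaces } L \subseteq \mathbb{R}^n\},$$ where $K-K=\{x-y : x,y\in K\}$. Let $m \ge 0$ be an integer and let $0 = j_0 < j_1 < \dots < j_m < j_{m+1} = n$ be integers such that 1. $\rho_{j_1}(K,\Lambda) > \rho_{j_2}(K,\Lambda) > \dots > \rho_{j_m}(K,\Lambda) > \rho_n(K,\Lambda)$, and 2. $\rho_j(K,\Lambda) \le \rho_{j_i}(K,\Lambda)$ for all $i \in \{1,\dots,m+1\}$ and all $j \in \{j_{i-1}+1,\dots,j_i\}$. Then $$\#(K\cap\Lambda) \le \prod_{i=1}^{m+1} \left\lfloor \frac{1}{\rho_{j_i}(K,\Lambda)} + 1 \right\rfloor^{j_i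 - j_{i-1}}.$$ -/

import Mathlib

open scoped Pointwise

/-- The `i`-th packing minimum of `K` with respect to the lattice `Λ` in a real vector space `E` of
dimension `n` (meaningful for `1 ≤ i ≤ n`): the infimum of all `ρ > 0` such that, for every linear
subspace `L` of dimension `n - i`, the set `ρ (K - K) + L` contains a point of `Λ` outside `L`,
i.e. `(ρ (K - K) + L) ∩ Λ ≠ L ∩ Λ`. Here `K - K` is the pointwise difference set. -/
noncomputable def packingMinimum {E : Type*} [AddCommGroup E] [Module ℝ E]
    (K : Set E) (Λ : Submodule ℤ E) (i : ℕ) : ℝ :=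
  sInf {ρ : ℝ | 0 < ρ ∧ ∀ L : Submodule ℝ E, Module.finrank ℝ L + i = Module.finrank ℝ E →
    (ρ • (K - K) + (L : Set E)) ∩ (Λ : Set E) ≠ (L : Set E) ∩ (Λ : Set E)}

/-! Put k_i = ⌊1/ρ_{j_i} + 1⌋, so that 1/k_i < ρ_{j_i}, and let V_i be the smallest subspace with
(k_i⁻¹(K - K) + V_i) ∩ Λ ⊆ V_i. Then dim V_i ≤ n - j_i. Minimality makes the V_i nested, which an
arbitrary choice of (n - j_i)-dimensional subspaces would not ensure.

Let A_0 = Λ and A_i = Λ ∩ V_i. If x, y ∈ K ∩ Λ have x - y ∈ A_{i-1} and agree modulo k_i in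
A_{i-1}/A_i, then x - y = k_i z + a with a ∈ A_i. So z ∈ k_i⁻¹(K - K) + V_i, whence z ∈ V_i and x -
y ∈ A_i (`card_le_residues_mul`). As A_{m+1} = 0, iteration gives #(K ∩ Λ) ≤ ∏ k_i^(rk A_{i-1} - rk
A_i). Since rk A_i ≤ n - j_i and the k_i are nondecreasing, `prod_pow_sub_le_prod_pow_sub` replaces
these exponents by j_i - j_{i-1}. -/

open Module in
/-- Residues modulo `k` of the coordinates of the free module `A / A'`. -/
theorem exists_residue_map {E : Type*} [AddCommGroup E] [Module ℝ E] (A A' : Submodule ℤ E)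
    [Module.Finite ℤ A] (hle : A' ≤ A) (htf : ∀ c : ℤ, c ≠ 0 → ∀ x ∈ A, c • x ∈ A' → x ∈ A')
    (k : ℕ) :
    ∃ f : E → (Fin (finrank ℤ A - finrank ℤ A') → ZMod k), ∀ x ∈ A, ∀ y ∈ A, f x = f y →
      ∃ z ∈ A, x - y - (k : ℤ) • z ∈ A' := by
  classical
  set N : Submodule ℤ A := A'.comap A.subtype with hN
  have hNr : finrank ℤ N = finrank ℤ A' :=
    (Submodule.comapSubtypeEquivOfLe hle).finrank_eq
  have htfQ : Module.IsTorsionFree ℤ (A ⧸ N) := by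
    rw [Module.isTorsionFree_iff_smul_eq_zero]
    intro c q h
    induction q using Submodule.Quotient.induction_on with
    | _ x =>
    by_cases hc : c = 0
    · exact Or.inl hc
    refine Or.inr ?_
    rw [← Submodule.Quotient.mk_smul, Submodule.Quotient.mk_eq_zero] at h
    rw [Submodule.Quotient.mk_eq_zero]
    exact htf c hc x x.2 h
  have hd : finrank ℤ (A ⧸ N) = finrank ℤ A - finrank ℤ A' := by
    have := Submodule.finrank_quotient_add_finrank N
    omega
  have b : Basis (Fin (finrank ℤ A - finrank ℤ A')) ℤ (A ⧸ N) := hd ▸ Module.finBasis ℤ (A ⧸ N)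
  refine ⟨fun x => if hx : x ∈ A then fun i => ((b.repr (N.mkQ ⟨x, hx⟩) i : ℤ) : ZMod k) else 0,
    fun x hx y hy h => ?_⟩
  simp only [hx, hy, dif_pos] at h
  have hdvd : ∀ i, (k : ℤ) ∣ b.repr (N.mkQ (⟨x, hx⟩ - ⟨y, hy⟩)) i := by
    intro i
    have := congrFun h i
    rw [← ZMod.intCast_zmod_eq_zero_iff_dvd]
    rw [map_sub, map_sub, Finsupp.sub_apply, Int.cast_sub, this, sub_self]
  choose c hc using hdvd
  obtain ⟨z, hz⟩ := N.mkQ_surjective (∑ i, c i • b i)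
  refine ⟨z, z.2, ?_⟩
  have : N.mkQ (⟨x, hx⟩ - ⟨y, hy⟩ - (k : ℤ) • z) = 0 := by
    rw [map_sub, map_smul, hz, ← b.sum_repr (N.mkQ (⟨x, hx⟩ - ⟨y, hy⟩)), sub_eq_zero,
      Finset.smul_sum]
    exact Finset.sum_congr rfl fun i _ => by rw [hc i, mul_smul]
  rw [Submodule.mkQ_apply, Submodule.Quotient.mk_eq_zero] at this
  exact this

/-! ### Separating subspaces and the residue count. -/

section Separating

variable {E : Type*} [AddCommGroup E] [Module ℝ E]

/-- The smallest subspace `L` such that `ρ (K - K) + L` contains no point of `Λ` outside `L`. -/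
def separatingSubspace (K : Set E) (Λ : Submodule ℤ E) (ρ : ℝ) : Submodule ℝ E :=
  sInf {L | (ρ • (K - K) + (L : Set E)) ∩ (Λ : Set E) ⊆ L}

/-- The defining condition is stable under intersections, so the infimum satisfies it too. -/
theorem mem_separatingSubspace {K : Set E} {Λ : Submodule ℤ E} {ρ : ℝ} {d v : E}
    (hd : d ∈ K - K) (hv : v ∈ separatingSubspace K Λ ρ) (hΛ : ρ • d + v ∈ Λ) :
    ρ • d + v ∈ separatingSubspace K Λ ρ := by
  rw [separatingSubspace, Submodule.mem_sInf] at hv ⊢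
  exact fun L hL => hL ⟨Set.add_mem_add (Set.smul_mem_smul_set hd) (hv L hL), hΛ⟩

theorem separatingSubspace_mono {K : Set E} (hK : Convex ℝ K) (Λ : Submodule ℤ E) {ρ σ : ℝ}
    (hρ : 0 < ρ) (h : ρ ≤ σ) : separatingSubspace K Λ ρ ≤ separatingSubspace K Λ σ := by
  refine sInf_le_sInf fun L hL => ?_
  refine subset_trans (Set.inter_subset_inter_left _ (Set.add_subset_add_right ?_)) hL
  rintro _ ⟨d, hd, rfl⟩
  have hσ : 0 < σ := hρ.trans_le h
  obtain ⟨x, hx, y, hy, rfl⟩ := id hd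
  have h0 : (0 : E) ∈ K - K := ⟨x, hx, x, hx, sub_self x⟩
  have ht : ρ / σ ∈ Set.Icc (0 : ℝ) 1 := ⟨by positivity, (div_le_one hσ).2 h⟩
  refine ⟨(ρ / σ) • (x - y), (hK.sub hK).smul_mem_of_zero_mem h0 hd ht, ?_⟩
  simp only [smul_smul]
  rw [mul_div_cancel₀ _ hσ.ne']

theorem exists_finrank_separatingSubspace_le (K : Set E) (Λ : Submodule ℤ E)
    {ρ : ℝ} (hρ : 0 < ρ) {i : ℕ} (h : ρ < packingMinimum K Λ i) :
    ∃ L : Submodule ℝ E, Module.finrank ℝ L + i = Module.finrank ℝ E ∧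
      separatingSubspace K Λ ρ ≤ L := by
  by_contra hcon
  push Not at hcon
  refine (csInf_le (⟨0, fun r hr => hr.1.le⟩ : BddBelow _) ?_).not_gt h
  refine ⟨hρ, fun L hL heq => ?_⟩
  exact hcon L hL (sInf_le (heq.subset.trans Set.inter_subset_left))

/-- One step of the count: refining by residues modulo `k`. -/
theorem card_le_residues_mul {K : Set E} {Λ A : Submodule ℤ E} [Module.Finite ℤ A] {k B : ℕ}
    (hk : 0 < k) (hA : A ≤ Λ)
    (hle : Λ ⊓ (separatingSubspace K Λ (1 / k)).restrictScalars ℤ ≤ A)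
    (hB : ∀ S : Finset E, (S : Set E) ⊆ K ∩ Λ → (∀ x ∈ S, ∀ y ∈ S, x - y ∈
      Λ ⊓ (separatingSubspace K Λ (1 / k)).restrictScalars ℤ) → S.card ≤ B)
    (S : Finset E) (hS : (S : Set E) ⊆ K ∩ Λ) (hSA : ∀ x ∈ S, ∀ y ∈ S, x - y ∈ A) :
    S.card ≤ k ^ (Module.finrank ℤ A - Module.finrank ℤ
      ↥(Λ ⊓ (separatingSubspace K Λ (1 / k)).restrictScalars ℤ)) * B := by
  classical
  set V := separatingSubspace K Λ (1 / k) with hV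
  set A' := Λ ⊓ V.restrictScalars ℤ with hA'
  have hk0 : (k : ℝ) ≠ 0 := by positivity
  have : NeZero k := ⟨hk.ne'⟩
  rcases S.eq_empty_or_nonempty with rfl | ⟨x₀, hx₀⟩
  · simp
  -- A lattice trace on a real subspace is saturated, so `A / A'` is torsion-free.
  obtain ⟨f, hf⟩ := exists_residue_map A A' hle (fun c hc x hx hcx => by
    refine ⟨hA hx, ?_⟩
    have h2 : (c : ℝ) • x ∈ V := by
      rw [Int.cast_smul_eq_zsmul]; exact hcx.2
    exact (V.smul_mem_iff (by exact_mod_cast hc)).1 h2) k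
  have hcard : (Finset.univ : Finset (Fin (Module.finrank ℤ A - Module.finrank ℤ A') →
      ZMod k)).card = k ^ (Module.finrank ℤ A - Module.finrank ℤ A') := by
    simp [ZMod.card]
  rw [← hcard, mul_comm]
  refine Finset.card_le_mul_card_image_of_maps_to (f := fun x => f (x - x₀))
    (fun x _ => Finset.mem_univ _) B fun q _ => ?_
  refine hB _ (fun x hx => hS (Finset.mem_of_mem_filter x hx)) fun x hx y hy => ?_
  rw [Finset.mem_filter] at hx hy
  obtain ⟨z, hz, hxz⟩ := hf _ (hSA x hx.1 x₀ hx₀) _ (hSA y hy.1 x₀ hx₀) (hx.2.trans hy.2.symm)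
  rw [sub_sub_sub_cancel_right] at hxz
  -- With a = x - y - kz ∈ V, this writes z as a point of k⁻¹(K - K) + V.
  have hzeq : z = (1 / k : ℝ) • (x - y) + (-(1 / k : ℝ)) • (x - y - (k : ℤ) • z) := by
    have : ((k : ℤ) • z) = (k : ℝ) • z := by
      rw [← Int.cast_smul_eq_zsmul ℝ]; simp
    rw [this, smul_sub (-(1 / k : ℝ)), smul_smul, neg_smul, neg_mul,
      one_div_mul_cancel hk0]
    simp
  have hzV : z ∈ V := by
    have := mem_separatingSubspace (Λ := Λ) (ρ := 1 / k)
      (Set.sub_mem_sub (hS hx.1).1 (hS hy.1).1) (V.smul_mem (-(1 / k : ℝ)) hxz.2)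
      (hzeq ▸ hA hz)
    rwa [← hzeq] at this
  have hzA' : z ∈ A' := ⟨hA hz, hzV⟩
  have := A'.add_mem hxz (A'.smul_mem (k : ℤ) hzA')
  rwa [sub_add_cancel] at this

end Separating

/-! ### Comparison of exponents. -/

/-- If the bases `k` are nondecreasing, moving weight to earlier factors decreases the product. -/
theorem prod_pow_sub_le_prod_pow_sub {k s j : ℕ → ℕ} {M : ℕ} (h0 : s 0 = j 0)
    (hk : ∀ i, 1 ≤ i → i < M → k i ≤ k (i + 1)) (hs : ∀ i < M, s i ≤ s (i + 1))
    (hj : ∀ i < M, j i ≤ j (i + 1)) (hjs : ∀ i ≤ M, j i ≤ s i) :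
    ∏ i ∈ Finset.Icc 1 M, k i ^ (s i - s (i - 1)) ≤
      (∏ i ∈ Finset.Icc 1 M, k i ^ (j i - j (i - 1))) * k M ^ (s M - j M) := by
  induction M with
  | zero => simp [h0]
  | succ M ih =>
    have ih := ih (fun i h1 h2 => hk i h1 (by omega)) (fun i hi => hs i (by omega))
      (fun i hi => hj i (by omega)) (fun i hi => hjs i (by omega))
    rw [Finset.prod_Icc_succ_top (by omega), Finset.prod_Icc_succ_top (by omega),
      Nat.add_sub_cancel]
    have hpow : k M ^ (s M - j M) ≤ k (M + 1) ^ (s M - j M) := by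
      rcases Nat.eq_zero_or_pos M with rfl | hM
      · simp [h0]
      · exact Nat.pow_le_pow_left (hk M hM (by omega)) _
    have h1 := hs M (by omega)
    have h2 := hj M (by omega)
    have h3 := hjs M (by omega)
    have h4 := hjs (M + 1) le_rfl
    calc _ ≤ ((∏ i ∈ Finset.Icc 1 M, k i ^ (j i - j (i - 1))) * k (M + 1) ^ (s M - j M)) *
          k (M + 1) ^ (s (M + 1) - s M) :=
          Nat.mul_le_mul_right _ (ih.trans (Nat.mul_le_mul_left _ hpow))
      _ = _ := by
          rw [mul_assoc, mul_assoc, ← pow_add, ← pow_add]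
          congr 2
          omega

/-! ### Positivity of the last minimum and auxiliary facts. -/

/-- Only L = 0 is tested. Nonzero lattice vectors have norm at least ε and K - K has radius at most
R, so every admissible ρ is at least ε / R. -/
theorem packingMinimum_finrank_pos {E : Type*} [NormedAddCommGroup E] [NormedSpace ℝ E]
    [FiniteDimensional ℝ E] [Nontrivial E] {K : Set E} (hb : Bornology.IsBounded K)
    (hK : (interior K).Nonempty) (Λ : Submodule ℤ E) [DiscreteTopology Λ] [IsZLattice ℝ Λ] :
    0 < packingMinimum K Λ (Module.finrank ℝ E) := by
  have hL : ∀ L : Submodule ℝ E, Module.finrank ℝ L + Module.finrank ℝ E = Module.finrank ℝ E →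
      L = ⊥ := fun L hL => Submodule.finrank_eq_zero.1 (by omega)
  obtain ⟨R, hR0, hR⟩ := (hb.sub hb).exists_pos_norm_le
  obtain ⟨ε, hε, hball⟩ : ∃ ε > 0, ∀ x ∈ Λ, ‖x‖ < ε → x = 0 := by
    obtain ⟨ε, hε, h⟩ := Metric.exists_ball_inter_eq_singleton_of_mem_discrete
      (isDiscrete_iff_discreteTopology.2 ‹DiscreteTopology Λ›) (Λ.zero_mem)
    refine ⟨ε, hε, fun x hx hn => ?_⟩
    have : x ∈ Metric.ball (0 : E) ε ∩ (Λ : Set E) := ⟨by simpa using hn, hx⟩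
    rw [h] at this
    exact this
  obtain ⟨v, hv, hv0⟩ : ∃ v ∈ Λ, v ≠ 0 := by
    by_contra! hcon
    have hspan := IsZLattice.span_top (K := ℝ) (L := Λ)
    rw [Submodule.span_eq_bot.2 hcon] at hspan
    exact bot_ne_top hspan
  obtain ⟨c, hc⟩ := hK
  obtain ⟨δ, hδ, hcδ⟩ := Metric.isOpen_iff.1 isOpen_interior c hc
  have hvn : 0 < ‖v‖ := norm_pos_iff.2 hv0
  refine lt_of_lt_of_le (div_pos hε hR0) (le_csInf ?_ ?_)
  -- An admissible ρ must exist, since `sInf ∅ = 0` in ℝ: scale K - K until it contains the lattice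
  -- vector v.
  · have ht : 0 < δ / (2 * ‖v‖) := by positivity
    refine ⟨(δ / (2 * ‖v‖))⁻¹, inv_pos.2 ht, fun L hLr heq => ?_⟩
    rw [hL L hLr] at heq
    have hmem : c + (δ / (2 * ‖v‖)) • v ∈ K := by
      refine interior_subset (hcδ ?_)
      rw [Metric.mem_ball, dist_self_add_left, norm_smul, Real.norm_of_nonneg ht.le]
      have : δ / (2 * ‖v‖) * ‖v‖ = δ / 2 := by field_simp
      linarith
    have : v ∈ ((⊥ : Submodule ℝ E) : Set E) ∩ (Λ : Set E) := by
      rw [← heq]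
      refine ⟨⟨v, ⟨_, Set.sub_mem_sub hmem (interior_subset hc), ?_⟩, 0, rfl, add_zero v⟩, hv⟩
      simp only [add_sub_cancel_left, smul_smul]
      rw [inv_mul_cancel₀ ht.ne', one_smul]
    exact hv0 this.1
  · rintro ρ ⟨hρ, h⟩
    by_contra! hlt
    refine h ⊥ (by simp) (Set.Subset.antisymm ?_ ?_)
    · rintro x ⟨⟨_, ⟨d, hd, rfl⟩, y, hy, rfl⟩, hx⟩
      obtain rfl : y = 0 := hy
      refine ⟨hball _ hx ?_, hx⟩
      simp only [add_zero, norm_smul, Real.norm_of_nonneg hρ.le]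
      calc ρ * ‖d‖ ≤ ρ * R := by gcongr; exact hR d hd
        _ < ε := (lt_div_iff₀ hR0).1 hlt
    · rintro x ⟨hx, hxΛ⟩
      obtain rfl : x = 0 := hx
      refine ⟨⟨0, ⟨0, ⟨c, interior_subset hc, c, interior_subset hc, sub_self c⟩, smul_zero _⟩,
        0, rfl, add_zero 0⟩, hxΛ⟩

theorem one_div_floor_one_div_add_one_lt {r : ℝ} (hr : 0 < r) :
    0 < ⌊1 / r + 1⌋₊ ∧ 1 / (⌊1 / r + 1⌋₊ : ℝ) < r := by
  have h0 : 0 < 1 / r := by positivity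
  have h1 : 0 < ⌊1 / r + 1⌋₊ := Nat.floor_pos.2 (by linarith)
  refine ⟨h1, ?_⟩
  have h2 := Nat.sub_one_lt_floor (1 / r + 1)
  rw [one_div_lt (by positivity) hr]
  linarith

theorem finrank_int_eq_finrank_span {E : Type*} [NormedAddCommGroup E] [NormedSpace ℝ E]
    [FiniteDimensional ℝ E] (A : Submodule ℤ E) (hA : DiscreteTopology A) :
    Module.finrank ℤ A = Module.finrank ℝ (Submodule.span ℝ (A : Set E)) := by
  have h : Submodule.span ℤ (A : Set E) = A := Submodule.span_eq A
  have := Real.finrank_eq_int_finrank_of_discrete (s := (A : Set E)) (h.symm ▸ hA)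
  rw [Set.finrank, Set.finrank, h] at this
  exact this.symm

/-! ### The main count. -/

theorem theorem4p6 (n : ℕ)
    (K : Set (EuclideanSpace ℝ (Fin n)))
    (hK_convex : Convex ℝ K) (hK_compact : IsCompact K) (hK_int : (interior K).Nonempty)
    (Λ : Submodule ℤ (EuclideanSpace ℝ (Fin n))) [DiscreteTopology Λ] [IsZLattice ℝ Λ]
    (m : ℕ) (j : ℕ → ℕ)
    (hj_zero : j 0 = 0) (hj_last : j (m + 1) = n)
    (hj_lt : ∀ i : ℕ, i ≤ m → j i < j (i + 1))
    (h_decr : ∀ i : ℕ, 1 ≤ i → i ≤ m →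
      packingMinimum K Λ (j (i + 1)) < packingMinimum K Λ (j i))
    (h_max : ∀ i : ℕ, 1 ≤ i → i ≤ m + 1 → ∀ k : ℕ, j (i - 1) < k → k ≤ j i →
      packingMinimum K Λ k ≤ packingMinimum K Λ (j i)) :
    (K ∩ (Λ : Set (EuclideanSpace ℝ (Fin n)))).encard ≤
      ((∏ i ∈ Finset.Icc 1 (m + 1),
        ⌊1 / packingMinimum K Λ (j i) + 1⌋₊ ^ (j i - j (i - 1)) : ℕ) : ℕ∞) := by
  have hn : 0 < n := by have := hj_lt m le_rfl; omega
  have : NeZero n := ⟨hn.ne'⟩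
  have hlast : 0 < packingMinimum K Λ (j (m + 1)) := by
    have := packingMinimum_finrank_pos hK_compact.isBounded hK_int Λ
    rwa [finrank_euclideanSpace_fin, show packingMinimum K Λ n = packingMinimum K Λ (j (m + 1)) by
      rw [hj_last]] at this
  have hpos : ∀ i ≤ m + 1, 1 ≤ i → 0 < packingMinimum K Λ (j i) := by
    intro i hi
    induction hi using Nat.decreasingInduction with
    | self => exact fun _ => hlast
    | of_succ i hi ih => exact fun h1 => (ih (by omega)).trans (h_decr i h1 (by omega))
  set k : ℕ → ℕ := fun i => ⌊1 / packingMinimum K Λ (j i) + 1⌋₊ with hk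
  have hkpos : ∀ i, 1 ≤ i → i ≤ m + 1 → 0 < k i := fun i h1 h2 =>
    (one_div_floor_one_div_add_one_lt (hpos i h2 h1)).1
  have hkmono : ∀ i, 1 ≤ i → i < m + 1 → k i ≤ k (i + 1) := fun i h1 h2 =>
    Nat.floor_mono (by
      gcongr
      · exact hpos (i + 1) (by omega) (by omega)
      · exact (h_decr i h1 (by omega)).le)
  let V : ℕ → Submodule ℝ (EuclideanSpace ℝ (Fin n)) := fun i =>
    separatingSubspace K Λ (1 / (k i : ℝ))
  -- The chain starts at Λ by convention: `j 0 = 0` has no packing minimum of its own.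
  let A : ℕ → Submodule ℤ (EuclideanSpace ℝ (Fin n)) := fun i =>
    if i = 0 then Λ else Λ ⊓ (V i).restrictScalars ℤ
  have hA0 : A 0 = Λ := if_pos rfl
  have hAs : ∀ i, A (i + 1) = Λ ⊓ (V (i + 1)).restrictScalars ℤ := fun i =>
    if_neg (Nat.succ_ne_zero i)
  have hAΛ : ∀ i, A i ≤ Λ := by
    rintro (_ | i)
    · exact hA0.le
    · exact (hAs i).le.trans inf_le_left
  have hAanti : ∀ i < m + 1, A (i + 1) ≤ A i := by
    rintro (_ | i) hi
    · rw [hA0]; exact hAΛ 1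
    · rw [hAs, hAs]
      refine inf_le_inf_left _ (separatingSubspace_mono hK_convex Λ ?_ ?_)
      · have := hkpos (i + 2) (by omega) (by omega)
        positivity
      · have := hkpos (i + 1) (by omega) (by omega)
        have := hkmono (i + 1) (by omega) (by omega)
        gcongr
  have hfin : Module.Finite ℤ Λ := ZLattice.module_finite ℝ Λ
  have hAfin : ∀ i, Module.Finite ℤ (A i) := fun i =>
    Module.Finite.of_injective (Submodule.inclusion (hAΛ i)) (Submodule.inclusion_injective _)
  let r : ℕ → ℕ := fun i => Module.finrank ℤ (A i)
  have hranti : ∀ i < m + 1, r (i + 1) ≤ r i := fun i hi =>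
    Submodule.finrank_mono (hAanti i hi)
  have hr0 : r 0 = n := by
    have := ZLattice.rank ℝ Λ
    rwa [finrank_euclideanSpace_fin] at this
  have hrj : ∀ i ≤ m + 1, r i + j i ≤ n := by
    rintro (_ | i) hi
    · rw [hr0, hj_zero, add_zero]
    · have hρ := one_div_floor_one_div_add_one_lt (hpos (i + 1) hi (by omega))
      obtain ⟨L, hL, hVL⟩ := exists_finrank_separatingSubspace_le K Λ
        (by have := hρ.1; positivity) hρ.2
      rw [finrank_euclideanSpace_fin] at hL
      have h1 : Module.finrank ℝ (V (i + 1)) ≤ Module.finrank ℝ L := Submodule.finrank_mono hVL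
      -- Discreteness makes the ℤ-rank equal to the dimension of the real span, which lies in V.
      have h2 : r (i + 1) ≤ Module.finrank ℝ (V (i + 1)) := by
        refine (finrank_int_eq_finrank_span (A (i + 1)) ?_).le.trans (Submodule.finrank_mono ?_)
        · exact DiscreteTopology.of_subset ‹DiscreteTopology Λ› (hAΛ (i + 1))
        · rw [Submodule.span_le]
          exact fun x hx => ((hAs i).le hx).2
      omega
  -- Downward induction, from differences in `A (m + 1) = ⊥` up to differences in Λ.
  have hcount : ∀ i ≤ m + 1, ∀ S : Finset (EuclideanSpace ℝ (Fin n)),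
      (S : Set (EuclideanSpace ℝ (Fin n))) ⊆ K ∩ Λ → (∀ x ∈ S, ∀ y ∈ S, x - y ∈ A i) →
      S.card ≤ ∏ l ∈ Finset.Ioc i (m + 1), k l ^ (r (l - 1) - r l) := by
    intro i hi
    induction hi using Nat.decreasingInduction with
    | self =>
      intro S hS hSA
      have hbot : A (m + 1) = ⊥ := by
        have := hAfin (m + 1)
        have := hrj (m + 1) le_rfl
        have := IsAddTorsionFree.of_isTorsionFree ℝ (EuclideanSpace ℝ (Fin n))
        exact Submodule.finrank_eq_zero.1 (by change r (m + 1) = 0; omega)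
      simp only [Finset.Ioc_self, Finset.prod_empty, Finset.card_le_one]
      intro x hx y hy
      have := hSA x hx y hy
      rw [hbot, Submodule.mem_bot, sub_eq_zero] at this
      exact this
    | of_succ i hi ih =>
      intro S hS hSA
      have hprod : ∏ l ∈ Finset.Ioc i (m + 1), k l ^ (r (l - 1) - r l) =
          k (i + 1) ^ (r i - r (i + 1)) *
            ∏ l ∈ Finset.Ioc (i + 1) (m + 1), k l ^ (r (l - 1) - r l) := by
        rw [← Finset.insert_Ioc_add_one_left_eq_Ioc (by omega), Finset.prod_insert (by simp)]
        simp
      have := hAfin i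
      have key := card_le_residues_mul (A := A i) (hkpos (i + 1) (by omega) (by omega)) (hAΛ i)
        ((hAs i).ge.trans (hAanti i hi)) (by rw [hAs] at ih; exact ih) S hS hSA
      rw [hprod]
      rw [← hAs] at key
      exact key
  have hcard : ∀ S : Finset (EuclideanSpace ℝ (Fin n)),
      (S : Set (EuclideanSpace ℝ (Fin n))) ⊆ K ∩ Λ →
      S.card ≤ ∏ i ∈ Finset.Icc 1 (m + 1), k i ^ (j i - j (i - 1)) := by
    intro S hS
    have h1 := hcount 0 (by omega) S hS fun x hx y hy => by
      rw [hA0]; exact Λ.sub_mem (hS hx).2 (hS hy).2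
    -- The corank n - rk A_i dominates j_i, with equality to n at both i = m + 1 values, so the
    -- correction factor is trivial.
    have h2 := prod_pow_sub_le_prod_pow_sub (k := k) (s := fun i => n - r i) (j := j)
      (M := m + 1) (by simp [hr0, hj_zero]) hkmono
      (fun i hi => by have := hranti i hi; omega)
      (fun i hi => (hj_lt i (by omega)).le)
      (fun i hi => by have := hrj i hi; omega)
    rw [show n - r (m + 1) - j (m + 1) = 0 by omega, pow_zero, mul_one] at h2
    refine h1.trans (le_trans (le_of_eq ?_) h2)
    refine Finset.prod_congr rfl fun i hi => ?_
    rw [Finset.mem_Icc] at hi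
    have e1 := hrj i hi.2
    have e2 := hrj (i - 1) (by omega)
    congr 1
    omega
  by_contra! hlt
  -- A subset with exactly one point too many is finite, so finiteness of K ∩ Λ need not be shown
  -- beforehand.
  obtain ⟨T, hT, hTc⟩ := Set.exists_subset_encard_eq (Order.add_one_le_of_lt hlt)
  have hTf : T.Finite := Set.finite_of_encard_eq_coe (by exact_mod_cast hTc)
  have h1 := hcard hTf.toFinset (by simpa using hT)
  rw [hTf.encard_eq_coe_toFinset_card] at hTc
  have h2 : hTf.toFinset.card = ∏ i ∈ Finset.Icc 1 (m + 1), k i ^ (j i - j (i - 1)) + 1 := by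
    exact_mod_cast hTc
  omega
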